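/- Modules are left modules and noetherian means left noetherian. Let $A=\bigoplus_{i\ge 0}A_i$ be an $\mathbb{N}$-graded ring such that $A_0$ is noetherian and semiperfect, each $A_i$ is a finitely generated left $A_0$-module, and $A_iA_j=A_{i+j}$ for all $i,j\ge 0$. Let $J=J(A_0)\oplus A_{\ge 1}$ be its graded Jacobson radical, where $J(A_0)$ is the Jacobson radical of $A_0$. For a ($\mathbb{Z}$-)graded $A$-module $M$ put $\operatorname{Gr}_J A=\bigoplus_{n\ge 0}J^n/J^{n+1}$ and $\operatorname{Gr}_J M=\bigoplus_{n\ge 0}J^nM/J^{n+1}M$, graded by $n$. A graded $A$-module $M$ is called Koszul if it has a graded projective resolution $\cdots\to P_1\xrightarrow{d_1}P_0\xrightarrow{d_0}M\to 0$ that is minimal ($\operatorname{im} d_{n+1}\subseteq JP_n$ for all $n\ge 0$) and satisfies $J^k\operatorname{Ker} d_n=\operatorname{Ker} d_n\cap J^{k+1}P_n$ for all $n,k\ge 0$. The ring $A$ is called Koszul if the graded $A$-module $A/J$ is Koszul. Over an $\mathbb{N}$-graded ring $B$ with $B_0$ artinian semisimple, a graded $B$-module $N$ is called classically Koszul if it is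 generated in degree $0$ and has a graded projective resolution $\cdots\to Q_1\to Q_0\to N\to 0$ with $Q_n$ generated in degree $n$ for every $n\ge 0$; $B$ is called classically Koszul if the graded $B$-module $B_0=B/B_{\ge 1}$ is classically Koszul. Then: 1. If $M$ is a Koszul $A$-module, then $\operatorname{Gr}_J M$ is a classically Koszul $\operatorname{Gr}_J A$-module (in particular $(\operatorname{Gr}_J A)_0$ is artinian semisimple). 2. If $A$ is a Koszul ring, then $\operatorname{Gr}_J A$ is a classically Koszul ring. -/

import Mathlib

open DirectSum

universe u v w

namespace GradedKoszul

/-! ### Rings -/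

/-- A ring `R` is semiperfect if `R / J(R)` is (artinian) semisimple and idempotents of `R / J(R)`
lift to `R`, where `J(R)` is the Jacobson radical. -/
structure IsSemiperfectRing (R : Type u) [Ring R] : Prop where
  semisimple : IsSemisimpleRing (R ⧸ Ring.jacobson R)
  lift : ∀ e : R ⧸ Ring.jacobson R, IsIdempotentElem e →
    ∃ f : R, IsIdempotentElem f ∧ Ideal.Quotient.mk (Ring.jacobson R) f = e

section Graded

variable {A : Type u} [Ring A] (𝒜 : ℕ → AddSubgroup A) [GradedRing 𝒜]

/-- Every `A_i` is finitely generated as a left module over the subring `A_0`. -/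
def LeftFinite : Prop :=
  ∀ i, ∃ s : Finset A,
    (Submodule.span (SetLike.GradeZero.subring 𝒜) (s : Set A) : Set A) = (𝒜 i : Set A)

open scoped Pointwise in
/-- `A_i A_j = A_{i+j}` for all `i, j`, where the product is the additive subgroup generated by
the products of elements. -/
def GeneratedInDegreeOne : Prop :=
  ∀ i j, 𝒜 i * 𝒜 j = 𝒜 (i + j)

/-- The graded Jacobson radical `J = J(A_0) ⊕ A_{≥ 1}`: the elements whose degree zero component
lies in the Jacobson radical of `A_0`. -/
def gradedJacobson : Ideal A :=
  (Ring.jacobson (𝒜 0)).comap (GradedRing.projZeroRingHom' 𝒜)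

instance : (gradedJacobson 𝒜).IsTwoSided := by
  unfold gradedJacobson; infer_instance

/-- The ideal `A_{≥ 1}`: the elements whose degree zero component vanishes. -/
def positivePart : Ideal A := RingHom.ker (GradedRing.projZeroRingHom' 𝒜)

end Graded

/-! ### Graded modules

Modules are left modules, graded by the integers. -/

/-- An `ℕ`-indexed family, regarded as a `ℤ`-indexed one vanishing in negative degrees. -/
def extendByBot {V : Type u} [AddGroup V] (𝒱 : ℕ → AddSubgroup V) : ℤ → AddSubgroup V
  | .ofNat n => 𝒱 n
  | .negSucc _ => ⊥

section Modules

variable {A : Type u} [Ring A] (𝒜 : ℕ → AddSubgroup A)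
variable {M : Type v} [AddCommGroup M] [Module A M]

/-- `M` is the internal direct sum of the `M_j`, and `A_i M_j ⊆ M_{i+j}`. -/
structure IsGradedModule (ℳ : ℤ → AddSubgroup M) : Prop where
  isInternal : DirectSum.IsInternal ℳ
  smul_mem : ∀ (i : ℕ) (j : ℤ) (a : A) (m : M), a ∈ 𝒜 i → m ∈ ℳ j → a • m ∈ ℳ (i + j)

variable (A) in
/-- `M` is generated as an `A`-module by its component of degree `i`. -/
def GeneratedInDegree (ℳ : ℤ → AddSubgroup M) (i : ℤ) : Prop :=
  Submodule.span A (ℳ i : Set M) = ⊤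

/-- The grading of `A / I` induced by the grading of `A` (for `I` a graded left ideal). -/
def quotientGrading (I : Ideal A) : ℤ → AddSubgroup (A ⧸ I) :=
  extendByBot fun n => (𝒜 n).map I.mkQ.toAddMonoidHom

/-- A graded projective resolution `⋯ → P 1 → P 0 → M → 0` of a graded `A`-module `M`: the modules
`P n` are graded and projective, the maps preserve degrees and the sequence is exact. -/
structure GradedProjectiveResolution (ℳ : ℤ → AddSubgroup M) where
  P : ℕ → Type w
  [addCommGroup : ∀ n, AddCommGroup (P n)]
  [module : ∀ n, Module A (P n)]
  grading : ∀ n, ℤ → AddSubgroup (P n)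
  isGraded : ∀ n, IsGradedModule 𝒜 (grading n)
  projective : ∀ n, Module.Projective A (P n)
  /-- the differential `P (n + 1) → P n` -/
  d : ∀ n, P (n + 1) →ₗ[A] P n
  /-- the augmentation `P 0 → M` -/
  ε : P 0 →ₗ[A] M
  d_mem : ∀ n i x, x ∈ grading (n + 1) i → d n x ∈ grading n i
  ε_mem : ∀ i x, x ∈ grading 0 i → ε x ∈ ℳ i
  exact : ∀ n, Function.Exact (d (n + 1)) (d n)
  exact_zero : Function.Exact (d 0) ε
  surjective : Function.Surjective ε

attribute [instance] GradedProjectiveResolution.addCommGroup GradedProjectiveResolution.module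

namespace GradedProjectiveResolution

variable {𝒜} {ℳ : ℤ → AddSubgroup M} (R : GradedProjectiveResolution.{u, v, w} 𝒜 ℳ)

/-- The kernel, inside `P n`, of the map leaving `P n` (that is `P n → P (n - 1)`, or the
augmentation `P 0 → M` for `n = 0`). -/
def kernel : ∀ n, Submodule A (R.P n)
  | 0 => LinearMap.ker R.ε
  | n + 1 => LinearMap.ker (R.d n)

/-- The image of `P (n + 1) → P n` is contained in `J (P n)`. -/
def IsMinimal [GradedRing 𝒜] : Prop :=
  ∀ n, LinearMap.range (R.d n) ≤ gradedJacobson 𝒜 • (⊤ : Submodule A (R.P n))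

/-- `P n` is generated in degree `n`. -/
def IsLinear : Prop :=
  ∀ n : ℕ, GeneratedInDegree A (R.grading n) n

end GradedProjectiveResolution

variable [GradedRing 𝒜]

/-- A graded module is Koszul if it has a minimal graded projective resolution such that
`J^k Ker d_n = Ker d_n ∩ J^{k+1} P_n` for all `n, k ≥ 0`. -/
def IsKoszulModule (ℳ : ℤ → AddSubgroup M) : Prop :=
  IsGradedModule 𝒜 ℳ ∧
  ∃ R : GradedProjectiveResolution.{u, v, max u v} 𝒜 ℳ, R.IsMinimal ∧
    ∀ n k : ℕ, gradedJacobson 𝒜 ^ k • R.kernel n =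
      R.kernel n ⊓ gradedJacobson 𝒜 ^ (k + 1) • (⊤ : Submodule A (R.P n))

/-- `A` is a Koszul ring if `A / J` is a Koszul module. -/
def IsKoszulRing : Prop :=
  IsKoszulModule 𝒜 (quotientGrading 𝒜 (gradedJacobson 𝒜))

/-- Classically Koszul modules over a graded ring `A` with `A_0` artinian semisimple: graded modules
generated in degree `0` that have a linear graded projective resolution. -/
def IsClassicallyKoszulModule (ℳ : ℤ → AddSubgroup M) : Prop :=
  IsSemisimpleRing (𝒜 0) ∧ IsGradedModule 𝒜 ℳ ∧ GeneratedInDegree A ℳ 0 ∧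
  ∃ R : GradedProjectiveResolution.{u, v, max u v} 𝒜 ℳ, R.IsLinear

/-- `A` is a classically Koszul ring if `A_0`, that is the graded module `A / A_{≥ 1}`, is a
classically Koszul module. -/
def IsClassicallyKoszulRing : Prop :=
  IsClassicallyKoszulModule 𝒜 (quotientGrading 𝒜 (positivePart 𝒜))

end Modules

/-! ### Associated graded rings and modules of adic filtrations -/

section Gr

variable {A : Type u} [Ring A] (I : Ideal A) (M : Type v) [AddCommGroup M] [Module A M]

/-- `I^n / I^{n+1}` -/
def GrRingPiece (n : ℕ) : Type u := ↥(I ^ n) ⧸ (I ^ (n + 1)).submoduleOf (I ^ n)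

/-- `I^n M / I^{n+1} M` -/
def GrModulePiece (n : ℕ) : Type v :=
  ↥(I ^ n • (⊤ : Submodule A M)) ⧸
    (I ^ (n + 1) • (⊤ : Submodule A M)).submoduleOf (I ^ n • (⊤ : Submodule A M))

instance (n : ℕ) : AddCommGroup (GrRingPiece I n) :=
  inferInstanceAs (AddCommGroup (↥(I ^ n) ⧸ (I ^ (n + 1)).submoduleOf (I ^ n)))

instance (n : ℕ) : AddCommGroup (GrModulePiece I M n) :=
  inferInstanceAs (AddCommGroup (↥(I ^ n • (⊤ : Submodule A M)) ⧸
    (I ^ (n + 1) • (⊤ : Submodule A M)).submoduleOf (I ^ n • (⊤ : Submodule A M))))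

/-- The associated graded ring `⨁ I^n / I^{n+1}`. -/
abbrev GrRing : Type u := ⨁ n, GrRingPiece I n

/-- The associated graded module `⨁ I^n M / I^{n+1} M`, a module over `GrRing I`. -/
abbrev GrModule : Type v := ⨁ n, GrModulePiece I M n

/-- The class in `I^n / I^{n+1}` of an element of `I^n`. -/
def GrRingPiece.mk (n : ℕ) : ↥(I ^ n) →+ GrRingPiece I n :=
  ((I ^ (n + 1)).submoduleOf (I ^ n)).mkQ.toAddMonoidHom

/-- The class in `I^n M / I^{n+1} M` of an element of `I^n M`. -/
def GrModulePiece.mk (n : ℕ) : ↥(I ^ n • (⊤ : Submodule A M)) →+ GrModulePiece I M n :=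
  ((I ^ (n + 1) • (⊤ : Submodule A M)).submoduleOf (I ^ n • (⊤ : Submodule A M))).mkQ.toAddMonoidHom

variable {I M}

theorem GrRingPiece.mk_surjective (n : ℕ) : Function.Surjective (GrRingPiece.mk I n) :=
  Submodule.mkQ_surjective _

theorem GrModulePiece.mk_surjective (n : ℕ) : Function.Surjective (GrModulePiece.mk I M n) :=
  Submodule.mkQ_surjective _

theorem GrRingPiece.mk_eq_iff {n : ℕ} (x y : ↥(I ^ n)) :
    GrRingPiece.mk I n x = GrRingPiece.mk I n y ↔ (x - y : A) ∈ I ^ (n + 1) :=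
  Submodule.Quotient.eq _

theorem GrModulePiece.mk_eq_iff {n : ℕ} (x y : ↥(I ^ n • (⊤ : Submodule A M))) :
    GrModulePiece.mk I M n x = GrModulePiece.mk I M n y ↔
      (x - y : M) ∈ I ^ (n + 1) • (⊤ : Submodule A M) :=
  Submodule.Quotient.eq _

/-- Classes of the same element in (propositionally) equal degrees agree. -/
theorem GrRingPiece.sigma_eq {m n : ℕ} (h : m = n) (x : ↥(I ^ m)) (y : ↥(I ^ n))
    (hxy : (x : A) = y) :
    GradedMonoid.mk (A := GrRingPiece I) m (GrRingPiece.mk I m x) =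
      GradedMonoid.mk n (GrRingPiece.mk I n y) := by
  subst h
  rw [Subtype.ext hxy]

theorem GrModulePiece.sigma_eq {m n : ℕ} (h : m = n) (x : ↥(I ^ m • (⊤ : Submodule A M)))
    (y : ↥(I ^ n • (⊤ : Submodule A M))) (hxy : (x : M) = y) :
    GradedMonoid.mk (A := GrModulePiece I M) m (GrModulePiece.mk I M m x) =
      GradedMonoid.mk n (GrModulePiece.mk I M n y) := by
  subst h
  rw [Subtype.ext hxy]

variable [I.IsTwoSided]

theorem pow_mul_mem {i j : ℕ} {a b : A} (ha : a ∈ I ^ i) (hb : b ∈ I ^ j) :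
    a * b ∈ I ^ (i + j) := by
  rw [Ideal.IsTwoSided.pow_add]
  exact Ideal.mul_mem_mul ha hb

theorem pow_smul_mem {i j : ℕ} {a : A} {m : M} (ha : a ∈ I ^ i)
    (hm : m ∈ I ^ j • (⊤ : Submodule A M)) : a • m ∈ I ^ (i + j) • (⊤ : Submodule A M) := by
  refine Submodule.smul_induction_on (p := fun x => a • x ∈ I ^ (i + j) • (⊤ : Submodule A M)) hm
    (fun b hb m _ => ?_) fun x y hx hy => ?_
  · rw [smul_smul]
    exact Submodule.smul_mem_smul (pow_mul_mem ha hb) trivial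
  · rw [smul_add]
    exact add_mem hx hy

/-- The product `I^i / I^{i+1} × I^j / I^{j+1} → I^{i+j} / I^{i+j+1}`. -/
def GrRingPiece.mul {i j : ℕ} : GrRingPiece I i → GrRingPiece I j → GrRingPiece I (i + j) :=
  Quotient.map₂ (fun a b => ⟨(a : A) * b, pow_mul_mem a.2 b.2⟩) (by
    intro a a' ha b b' hb
    have ha' := (GrRingPiece.mk_eq_iff a a').1 (Quotient.sound ha)
    have hb' := (GrRingPiece.mk_eq_iff b b').1 (Quotient.sound hb)
    refine Quotient.exact ((GrRingPiece.mk_eq_iff _ _).2 ?_)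
    have h1 : (a - a' : A) * b ∈ I ^ (i + j + 1) := by
      have := pow_mul_mem ha' b.2
      rwa [show i + 1 + j = i + j + 1 by omega] at this
    have h2 : (a' : A) * (b - b') ∈ I ^ (i + (j + 1)) := pow_mul_mem a'.2 hb'
    have := add_mem h1 h2
    rwa [show (a - a' : A) * b + a' * (b - b') = a * b - a' * b' by noncomm_ring] at this)

/-- The action `I^i / I^{i+1} × I^j M / I^{j+1} M → I^{i+j} M / I^{i+j+1} M`. -/
def GrModulePiece.smul {i j : ℕ} :
    GrRingPiece I i → GrModulePiece I M j → GrModulePiece I M (i + j) :=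
  Quotient.map₂ (fun a m => ⟨(a : A) • (m : M), pow_smul_mem a.2 m.2⟩) (by
    intro a a' ha b b' hb
    have ha' := (GrRingPiece.mk_eq_iff a a').1 (Quotient.sound ha)
    have hb' := (GrModulePiece.mk_eq_iff b b').1 (Quotient.sound hb)
    refine Quotient.exact ((GrModulePiece.mk_eq_iff _ _).2 ?_)
    have h1 : (a - a' : A) • (b : M) ∈ I ^ (i + j + 1) • (⊤ : Submodule A M) := by
      have := pow_smul_mem ha' b.2
      rwa [show i + 1 + j = i + j + 1 by omega] at this
    have h2 : (a' : A) • (b - b' : M) ∈ I ^ (i + (j + 1)) • (⊤ : Submodule A M) :=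
      pow_smul_mem a'.2 hb'
    have := add_mem h1 h2
    rwa [show (a - a' : A) • (b : M) + (a' : A) • (b - b' : M) = (a : A) • (b : M) -
      (a' : A) • (b' : M) by rw [sub_smul, smul_sub]; abel] at this)

theorem GrRingPiece.mul_mk {i j : ℕ} (a : ↥(I ^ i)) (b : ↥(I ^ j)) :
    GrRingPiece.mul (GrRingPiece.mk I i a) (GrRingPiece.mk I j b) =
      GrRingPiece.mk I (i + j) ⟨(a : A) * b, pow_mul_mem a.2 b.2⟩ := rfl

theorem GrModulePiece.smul_mk {i j : ℕ} (a : ↥(I ^ i)) (m : ↥(I ^ j • (⊤ : Submodule A M))) :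
    GrModulePiece.smul (GrRingPiece.mk I i a) (GrModulePiece.mk I M j m) =
      GrModulePiece.mk I M (i + j) ⟨(a : A) • (m : M), pow_smul_mem a.2 m.2⟩ := rfl

/-- The class of `1` in `A / I`. -/
def GrRingPiece.one : GrRingPiece I 0 :=
  GrRingPiece.mk I 0 ⟨1, by rw [Submodule.pow_zero, Ideal.one_eq_top]; trivial⟩

instance : GradedMonoid.GMul (GrRingPiece I) := ⟨GrRingPiece.mul⟩

instance : GradedMonoid.GOne (GrRingPiece I) := ⟨GrRingPiece.one⟩

instance : GradedMonoid.GMonoid (GrRingPiece I) where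
  one_mul := by
    rintro ⟨i, a⟩
    obtain ⟨a, rfl⟩ := GrRingPiece.mk_surjective i a
    exact GrRingPiece.sigma_eq (zero_add i) _ _ (one_mul _)
  mul_one := by
    rintro ⟨i, a⟩
    obtain ⟨a, rfl⟩ := GrRingPiece.mk_surjective i a
    exact GrRingPiece.sigma_eq (add_zero i) _ _ (mul_one _)
  mul_assoc := by
    rintro ⟨i, a⟩ ⟨j, b⟩ ⟨k, c⟩
    obtain ⟨a, rfl⟩ := GrRingPiece.mk_surjective i a
    obtain ⟨b, rfl⟩ := GrRingPiece.mk_surjective j b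
    obtain ⟨c, rfl⟩ := GrRingPiece.mk_surjective k c
    exact GrRingPiece.sigma_eq (add_assoc i j k) _ _ (mul_assoc _ _ _)

instance : DirectSum.GRing (GrRingPiece I) where
  mul_zero {i j} a := by
    obtain ⟨a, rfl⟩ := GrRingPiece.mk_surjective i a
    rw [← map_zero (GrRingPiece.mk I j)]
    refine (GrRingPiece.mul_mk _ _).trans ((GrRingPiece.mk_eq_iff _ 0).2 ?_)
    simp
  zero_mul {i j} b := by
    obtain ⟨b, rfl⟩ := GrRingPiece.mk_surjective j b
    rw [← map_zero (GrRingPiece.mk I i)]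
    refine (GrRingPiece.mul_mk _ _).trans ((GrRingPiece.mk_eq_iff _ 0).2 ?_)
    simp
  mul_add {i j} a b c := by
    obtain ⟨a, rfl⟩ := GrRingPiece.mk_surjective i a
    obtain ⟨b, rfl⟩ := GrRingPiece.mk_surjective j b
    obtain ⟨c, rfl⟩ := GrRingPiece.mk_surjective j c
    refine Eq.trans ?_ (map_add (GrRingPiece.mk I (i + j)) _ _)
    exact congrArg (GrRingPiece.mk I (i + j)) (Subtype.ext (mul_add (a : A) b c))
  add_mul {i j} a b c := by
    obtain ⟨a, rfl⟩ := GrRingPiece.mk_surjective i a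
    obtain ⟨b, rfl⟩ := GrRingPiece.mk_surjective i b
    obtain ⟨c, rfl⟩ := GrRingPiece.mk_surjective j c
    refine Eq.trans ?_ (map_add (GrRingPiece.mk I (i + j)) _ _)
    exact congrArg (GrRingPiece.mk I (i + j)) (Subtype.ext (add_mul (a : A) b c))
  natCast n := n • GrRingPiece.one
  natCast_zero := zero_smul _ _
  natCast_succ n := succ_nsmul _ n
  intCast n := n • GrRingPiece.one
  intCast_ofNat n := natCast_zsmul _ n
  intCast_negSucc_ofNat n := negSucc_zsmul _ n

instance : DirectSum.Gmodule (GrRingPiece I) (GrModulePiece I M) where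
  smul := GrModulePiece.smul
  one_smul := by
    rintro ⟨i, m⟩
    obtain ⟨m, rfl⟩ := GrModulePiece.mk_surjective i m
    exact GrModulePiece.sigma_eq (zero_add i) _ _ (one_smul _ _)
  mul_smul := by
    rintro ⟨i, a⟩ ⟨j, b⟩ ⟨k, m⟩
    obtain ⟨a, rfl⟩ := GrRingPiece.mk_surjective i a
    obtain ⟨b, rfl⟩ := GrRingPiece.mk_surjective j b
    obtain ⟨m, rfl⟩ := GrModulePiece.mk_surjective k m
    exact GrModulePiece.sigma_eq (add_assoc i j k) _ _ (mul_smul _ _ _)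
  smul_add {i j} a b c := by
    obtain ⟨a, rfl⟩ := GrRingPiece.mk_surjective i a
    obtain ⟨b, rfl⟩ := GrModulePiece.mk_surjective j b
    obtain ⟨c, rfl⟩ := GrModulePiece.mk_surjective j c
    refine Eq.trans ?_ (map_add (GrModulePiece.mk I M (i + j)) _ _)
    exact congrArg (GrModulePiece.mk I M (i + j)) (Subtype.ext (smul_add (a : A) (b : M) c))
  smul_zero {i j} a := by
    obtain ⟨a, rfl⟩ := GrRingPiece.mk_surjective i a
    rw [← map_zero (GrModulePiece.mk I M j)]
    refine (GrModulePiece.smul_mk _ _).trans ((GrModulePiece.mk_eq_iff _ 0).2 ?_)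
    simp
  add_smul {i j} a b c := by
    obtain ⟨a, rfl⟩ := GrRingPiece.mk_surjective i a
    obtain ⟨b, rfl⟩ := GrRingPiece.mk_surjective i b
    obtain ⟨c, rfl⟩ := GrModulePiece.mk_surjective j c
    refine Eq.trans ?_ (map_add (GrModulePiece.mk I M (i + j)) _ _)
    exact congrArg (GrModulePiece.mk I M (i + j)) (Subtype.ext (add_smul (a : A) b (c : M)))
  zero_smul {i j} b := by
    obtain ⟨b, rfl⟩ := GrModulePiece.mk_surjective j b
    rw [← map_zero (GrRingPiece.mk I i)]
    refine (GrModulePiece.smul_mk _ _).trans ((GrModulePiece.mk_eq_iff _ 0).2 ?_)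
    simp

variable (I M)

/-- The component `I^n / I^{n+1}` of `GrRing I`. -/
def grRingGrading (n : ℕ) : AddSubgroup (GrRing I) := (DirectSum.of (GrRingPiece I) n).range

/-- The component `I^n M / I^{n+1} M` of `GrModule I M` (zero in negative degrees). -/
def grModuleGrading : ℤ → AddSubgroup (GrModule I M) :=
  extendByBot fun n => (DirectSum.of (GrModulePiece I M) n).range

instance : SetLike.GradedMonoid (grRingGrading I) where
  one_mem := ⟨GrRingPiece.one, rfl⟩
  mul_mem := by
    rintro i j _ _ ⟨a, rfl⟩ ⟨b, rfl⟩
    exact ⟨_, (DirectSum.of_mul_of a b).symm⟩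

/-- The identification of `I^n / I^{n+1}` with a component of `GrRing I`. -/
def toGrRingGrading (n : ℕ) : GrRingPiece I n →+ grRingGrading I n :=
  (DirectSum.of (GrRingPiece I) n).rangeRestrict

instance : DirectSum.Decomposition (grRingGrading I) :=
  DirectSum.Decomposition.ofAddHom _
    (DirectSum.toAddMonoid fun n =>
      (DirectSum.of (fun n => grRingGrading I n) n).comp (toGrRingGrading I n))
    (by
      ext n x : 2
      simp only [AddMonoidHom.comp_apply, DirectSum.toAddMonoid_of,
        DirectSum.coeAddMonoidHom_of, AddMonoidHom.id_apply]
      rfl)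
    (by
      ext n x : 2
      obtain ⟨_, a, rfl⟩ := x
      simp only [AddMonoidHom.comp_apply, DirectSum.toAddMonoid_of,
        DirectSum.coeAddMonoidHom_of, AddMonoidHom.id_apply]
      rfl)

instance : GradedRing (grRingGrading I) where

end Gr

end GradedKoszul

open GradedKoszul

/-! The resolution of `Gr_J M` is the associated graded of the given minimal resolution `P` of `M`.
Minimality says `d` maps `P (n + 1)` into `J P n`, so `d` induces maps on associated graded modules
that raise the degree by one (`grMap` with `s = 1`). Shifting the grading of `Gr_J (P n)` by `n`
makes these maps degree-preserving. Any `Gr_J N` is generated in degree 0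
(`generatedInDegree_zero_grModuleGrading`), so after the shift the `n`-th term is generated in
degree `n`.

Projectivity survives because `Gr_J` of a free module is free on the classes of a basis, and `Gr_J`
preserves retracts (`projective_grModule`). Exactness is the essential point: associated graded
complexes of exact complexes are exact only under strictness, and the identity `J^k Ker d_n = Ker
d_n ∩ J^{k+1} P_n` is exactly this strictness, used both at the term in question and at the next one
to the right (`exact_grMap`). The degree 0 part of `Gr_J A` is a quotient of `A_0 / J(A_0)`, hence
semisimple.

For the ring statement, apply this to `M = A / J`: multiplying the class of 1 gives `Gr_J A → Gr_J
(A / J)`, surjective with kernel the positive part (`ker_grQuotientProj`), so `Gr_J (A / J)` is the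
trivial module over `Gr_J A`. -/

namespace GradedKoszul

/-! ### Calculus of homogeneous elements -/

section Elements

variable {A : Type u} [Ring A] {I : Ideal A}
variable {M : Type v} [AddCommGroup M] [Module A M]

/-- The homogeneous element of degree `n` of `GrRing I` given by an element of `I^n`. -/
def grRingOf (n : ℕ) (a : A) (ha : a ∈ I ^ n) : GrRing I :=
  DirectSum.of (GrRingPiece I) n (GrRingPiece.mk I n ⟨a, ha⟩)

/-- The homogeneous element of degree `n` of `GrModule I M` given by an element of `I^n M`. -/
def grOf (n : ℕ) (x : M) (hx : x ∈ I ^ n • (⊤ : Submodule A M)) : GrModule I M :=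
  DirectSum.of (GrModulePiece I M) n (GrModulePiece.mk I M n ⟨x, hx⟩)

theorem mem_pow_zero (a : A) : a ∈ I ^ 0 := by
  rw [Submodule.pow_zero, Ideal.one_eq_top]; trivial

theorem mem_pow_zero_smul_top (x : M) : x ∈ I ^ 0 • (⊤ : Submodule A M) := by
  rw [Submodule.pow_zero, Ideal.one_eq_top, Submodule.top_smul]; trivial

/-- Degrees such as `i + j + s` and `i + (j + s)` agree only propositionally; this lemma absorbs the
transport between the corresponding summands. -/
theorem grOf_congr {m n : ℕ} (h : m = n) {x y : M} (hxy : x = y)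
    (hx : x ∈ I ^ m • (⊤ : Submodule A M)) (hy : y ∈ I ^ n • (⊤ : Submodule A M)) :
    grOf m x hx = grOf n y hy := by
  subst h hxy; rfl

theorem grOf_add (n : ℕ) {x y : M} (hx : x ∈ I ^ n • (⊤ : Submodule A M))
    (hy : y ∈ I ^ n • (⊤ : Submodule A M)) :
    grOf n (x + y) (add_mem hx hy) = grOf n x hx + grOf n y hy := by
  unfold grOf
  rw [← map_add, ← map_add]; rfl

theorem grOf_eq_iff {n : ℕ} {x y : M} (hx : x ∈ I ^ n • (⊤ : Submodule A M))
    (hy : y ∈ I ^ n • (⊤ : Submodule A M)) :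
    grOf n x hx = grOf n y hy ↔ x - y ∈ I ^ (n + 1) • (⊤ : Submodule A M) := by
  unfold grOf
  rw [(DirectSum.of_injective n).eq_iff, GrModulePiece.mk_eq_iff]

theorem grOf_eq_zero_iff {n : ℕ} {x : M} (hx : x ∈ I ^ n • (⊤ : Submodule A M)) :
    grOf n x hx = 0 ↔ x ∈ I ^ (n + 1) • (⊤ : Submodule A M) := by
  have h : grOf n (0 : M) (zero_mem _) = (0 : GrModule I M) := by
    unfold grOf
    rw [show (⟨0, zero_mem _⟩ : ↥(I ^ n • (⊤ : Submodule A M))) = 0 from rfl, map_zero, map_zero]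
  rw [← h, grOf_eq_iff, sub_zero]

theorem grRingOf_eq_zero_iff {n : ℕ} {a : A} (ha : a ∈ I ^ n) :
    grRingOf n a ha = 0 ↔ a ∈ I ^ (n + 1) := by
  unfold grRingOf
  rw [← map_zero (DirectSum.of (GrRingPiece I) n), (DirectSum.of_injective n).eq_iff,
    ← map_zero (GrRingPiece.mk I n), GrRingPiece.mk_eq_iff]
  simp

theorem exists_grOf_eq (n : ℕ) (z : GrModulePiece I M n) :
    ∃ x hx, grOf n x hx = DirectSum.of (GrModulePiece I M) n z := by
  obtain ⟨⟨x, hx⟩, rfl⟩ := GrModulePiece.mk_surjective n z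
  exact ⟨x, hx, rfl⟩

theorem exists_grRingOf_eq (n : ℕ) (z : GrRingPiece I n) :
    ∃ a ha, grRingOf n a ha = DirectSum.of (GrRingPiece I) n z := by
  obtain ⟨⟨x, hx⟩, rfl⟩ := GrRingPiece.mk_surjective n z
  exact ⟨x, hx, rfl⟩

@[elab_as_elim]
theorem GrModule.induction {p : GrModule I M → Prop} (z : GrModule I M) (zero : p 0)
    (of : ∀ n x hx, p (grOf n x hx)) (add : ∀ x y, p x → p y → p (x + y)) : p z := by
  induction z using DirectSum.induction_on with
  | zero => exact zero
  | of n z => obtain ⟨x, hx, h⟩ := exists_grOf_eq n z; exact h ▸ of n x hx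
  | add x y hx hy => exact add x y hx hy

@[elab_as_elim]
theorem GrRing.induction {p : GrRing I → Prop} (z : GrRing I) (zero : p 0)
    (of : ∀ n x hx, p (grRingOf n x hx)) (add : ∀ x y, p x → p y → p (x + y)) : p z := by
  induction z using DirectSum.induction_on with
  | zero => exact zero
  | of n z => obtain ⟨x, hx, h⟩ := exists_grRingOf_eq n z; exact h ▸ of n x hx
  | add x y hx hy => exact add x y hx hy

theorem mem_grRingGrading_iff [I.IsTwoSided] {n : ℕ} {z : GrRing I} :
    z ∈ grRingGrading I n ↔ ∃ a ha, grRingOf n a ha = z := by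
  constructor
  · rintro ⟨z, rfl⟩; exact exists_grRingOf_eq n z
  · rintro ⟨a, ha, rfl⟩; exact ⟨_, rfl⟩

theorem mem_grModuleGrading_natCast_iff {n : ℕ} {z : GrModule I M} :
    z ∈ grModuleGrading I M n ↔ ∃ x hx, grOf n x hx = z := by
  constructor
  · rintro ⟨z, rfl⟩; exact exists_grOf_eq n z
  · rintro ⟨a, ha, rfl⟩; exact ⟨_, rfl⟩

/-- A homogeneous element of negative degree vanishes; one of degree `n ≥ 0` comes from `I^n M`. -/
theorem mem_grModuleGrading_iff {j : ℤ} {z : GrModule I M} :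
    z ∈ grModuleGrading I M j ↔ z = 0 ∨ ∃ (n : ℕ) (x : M) (hx : _), j = n ∧ grOf n x hx = z := by
  constructor
  · intro h
    match j, h with
    | .ofNat n, h =>
      obtain ⟨x, hx, rfl⟩ := mem_grModuleGrading_natCast_iff.1 h
      exact Or.inr ⟨n, x, hx, rfl, rfl⟩
    | .negSucc n, h => exact Or.inl h
  · rintro (rfl | ⟨n, x, hx, rfl, rfl⟩)
    · exact zero_mem _
    · exact mem_grModuleGrading_natCast_iff.2 ⟨x, hx, rfl⟩

variable [I.IsTwoSided]

theorem grRingOf_smul_grOf {i j : ℕ} {a : A} {x : M} (ha : a ∈ I ^ i)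
    (hx : x ∈ I ^ j • (⊤ : Submodule A M)) :
    grRingOf i a ha • grOf j x hx = grOf (i + j) (a • x) (pow_smul_mem ha hx) :=
  DirectSum.Gmodule.of_smul_of _ _ _ _

theorem grRingOf_mul_grRingOf {i j : ℕ} {a b : A} (ha : a ∈ I ^ i) (hb : b ∈ I ^ j) :
    grRingOf i a ha * grRingOf j b hb = grRingOf (i + j) (a * b) (pow_mul_mem ha hb) :=
  DirectSum.of_mul_of _ _

end Elements

/-! ### Functoriality of the associated graded module -/

section Map

variable {A : Type u} [Ring A] {I : Ideal A}
variable {M : Type v} [AddCommGroup M] [Module A M] {N : Type w} [AddCommGroup N] [Module A N]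

theorem range_le_pow_zero (f : M →ₗ[A] N) :
    LinearMap.range f ≤ I ^ 0 • (⊤ : Submodule A N) :=
  fun _ _ => mem_pow_zero_smul_top _

theorem map_mem_of_range_le [I.IsTwoSided] {f : M →ₗ[A] N} {s : ℕ}
    (hf : LinearMap.range f ≤ I ^ s • (⊤ : Submodule A N))
    {n : ℕ} {x : M} (hx : x ∈ I ^ n • (⊤ : Submodule A M)) :
    f x ∈ I ^ (n + s) • (⊤ : Submodule A N) := by
  have h : f x ∈ (I ^ n • (⊤ : Submodule A M)).map f := ⟨x, hx, rfl⟩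
  rw [Submodule.map_smul'', Submodule.map_top] at h
  rw [Ideal.IsTwoSided.pow_add, Submodule.mul_smul]
  exact Submodule.smul_mono le_rfl hf h

variable [I.IsTwoSided] (f : M →ₗ[A] N) (s : ℕ)
  (hf : LinearMap.range f ≤ I ^ s • (⊤ : Submodule A N))

/-- The map `I^n M / I^{n+1} M → I^{n+s} N / I^{n+s+1} N` induced by a map `M → I^s N`. -/
def grPieceMap (n : ℕ) : GrModulePiece I M n →+ GrModulePiece I N (n + s) :=
  (Submodule.mapQ _ _ (f.restrict (p := I ^ n • (⊤ : Submodule A M))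
    (q := I ^ (n + s) • (⊤ : Submodule A N)) fun _ hx => map_mem_of_range_le hf hx) (by
      intro x hx
      have := map_mem_of_range_le hf (n := n + 1) hx
      rwa [show n + 1 + s = n + s + 1 by omega] at this)).toAddMonoidHom

theorem toAddMonoid_grPieceMap_grOf {n : ℕ} {x : M} (hx : x ∈ I ^ n • (⊤ : Submodule A M)) :
    DirectSum.toAddMonoid (fun n =>
      (DirectSum.of (GrModulePiece I N) (n + s)).comp (grPieceMap f s hf n)) (grOf n x hx) =
      grOf (n + s) (f x) (map_mem_of_range_le hf hx) := by
  unfold grOf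
  rw [DirectSum.toAddMonoid_of]; rfl

/-- The map `GrModule I M → GrModule I N`, raising degrees by `s`, induced by a map
`M → I^s N`. -/
def grMap : GrModule I M →ₗ[GrRing I] GrModule I N where
  __ := DirectSum.toAddMonoid fun n =>
    (DirectSum.of (GrModulePiece I N) (n + s)).comp (grPieceMap f s hf n)
  map_smul' r z := by
    simp only [ZeroHom.toFun_eq_coe, AddMonoidHom.toZeroHom_coe, RingHom.id_apply]
    induction r using GrRing.induction with
    | zero => simp only [zero_smul, map_zero]
    | add x y hx hy => simp only [add_smul, map_add, hx, hy]
    | of i a ha =>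
      induction z using GrModule.induction with
      | zero => simp only [smul_zero, map_zero]
      | add x y hx hy => simp only [smul_add, map_add, hx, hy]
      | of j x hx =>
        rw [grRingOf_smul_grOf, toAddMonoid_grPieceMap_grOf, toAddMonoid_grPieceMap_grOf,
          grRingOf_smul_grOf]
        exact grOf_congr (add_assoc i j s) (map_smul f a x) _ _

theorem grMap_grOf {n : ℕ} {x : M} (hx : x ∈ I ^ n • (⊤ : Submodule A M)) :
    grMap f s hf (grOf n x hx) = grOf (n + s) (f x) (map_mem_of_range_le hf hx) :=
  toAddMonoid_grPieceMap_grOf f s hf hx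

/-- Since the induced map is homogeneous of degree `s`, its kernel is a graded submodule, so
exactness can be tested on homogeneous elements. -/
theorem grMap_apply (z : GrModule I M) (n : ℕ) :
    grMap f s hf z (n + s) = grPieceMap f s hf n (z n) := by
  induction z using DirectSum.induction_on with
  | zero => simp only [map_zero, DirectSum.zero_apply]
  | add x y hx hy => simp only [map_add, DirectSum.add_apply, hx, hy]
  | of i z =>
    have h : grMap f s hf (DirectSum.of _ i z) = DirectSum.of _ (i + s) (grPieceMap f s hf i z) :=
      DirectSum.toAddMonoid_of _ _ _
    rw [h]
    obtain rfl | hne := eq_or_ne i n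
    · rw [DirectSum.of_eq_same, DirectSum.of_eq_same]
    · rw [DirectSum.of_eq_of_ne _ _ _ (by omega), DirectSum.of_eq_of_ne _ _ _ (by omega), map_zero]

/-- The components of an element of the kernel of `grMap f` belong to the kernel. -/
theorem mem_of_grMap_eq_zero {S : Submodule (GrRing I) (GrModule I M)}
    (hS : ∀ n x hx, grMap f s hf (grOf n x hx) = 0 → grOf n x hx ∈ S)
    {z : GrModule I M} (hz : grMap f s hf z = 0) : z ∈ S := by
  classical
  rw [← DirectSum.sum_support_of z]
  refine Submodule.sum_mem _ fun n _ => ?_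
  obtain ⟨x, hx, h⟩ := exists_grOf_eq n (z n)
  rw [← h]
  refine hS n x hx ?_
  have h0 := grMap_apply f s hf z n
  rw [hz, DirectSum.zero_apply] at h0
  have h1 : grMap f s hf (DirectSum.of _ n (z n)) =
      DirectSum.of _ (n + s) (grPieceMap f s hf n (z n)) := DirectSum.toAddMonoid_of _ _ _
  rw [h, h1, ← h0, map_zero]

theorem grMap_mem_grModuleGrading {j : ℤ} {z : GrModule I M} (hz : z ∈ grModuleGrading I M j) :
    grMap f s hf z ∈ grModuleGrading I N (j + s) := by
  obtain rfl | ⟨n, x, hx, rfl, rfl⟩ := mem_grModuleGrading_iff.1 hz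
  · rw [map_zero]; exact zero_mem _
  · rw [grMap_grOf, ← Nat.cast_add]
    exact mem_grModuleGrading_natCast_iff.2 ⟨_, _, rfl⟩

end Map

/-! ### Associated graded modules of free and projective modules -/

section Projective

variable {A : Type u} [Ring A] {I : Ideal A} [I.IsTwoSided]

/-- `I^n • ⊤` is spanned by products `r * b` with `r ∈ I^n` and `b` arbitrary, and these stay in
`I^n` because `I` is two-sided. -/
theorem mem_pow_of_mem_pow_smul_top {n : ℕ} {a : A} (ha : a ∈ I ^ n • (⊤ : Submodule A A)) :
    a ∈ I ^ n := by
  refine Submodule.smul_induction_on ha (fun r hr b _ => ?_) fun _ _ => add_mem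
  have := pow_mul_mem hr (mem_pow_zero (I := I) b)
  rwa [add_zero] at this

variable (I) in
/-- The identity, as a map from the associated graded pieces of the module `A` to those of the
ring `A`. -/
def grPieceSelf (n : ℕ) : GrModulePiece I A n →+ GrRingPiece I n :=
  (Submodule.mapQ _ _ (Submodule.inclusion (p := I ^ n • (⊤ : Submodule A A)) (p' := I ^ n)
    fun _ => mem_pow_of_mem_pow_smul_top) (by
      intro x hx
      exact mem_pow_of_mem_pow_smul_top (n := n + 1) hx)).toAddMonoidHom

theorem toAddMonoid_grPieceSelf_grOf {n : ℕ} {a : A} (ha : a ∈ I ^ n • (⊤ : Submodule A A)) :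
    DirectSum.toAddMonoid (fun n => (DirectSum.of (GrRingPiece I) n).comp (grPieceSelf I n))
      (grOf n a ha) = grRingOf n a (mem_pow_of_mem_pow_smul_top ha) := by
  unfold grOf
  rw [DirectSum.toAddMonoid_of]; rfl

variable (I) in
/-- The associated graded module of `A` maps to the associated graded ring. -/
def grModuleSelf : GrModule I A →ₗ[GrRing I] GrRing I where
  __ := DirectSum.toAddMonoid fun n => (DirectSum.of (GrRingPiece I) n).comp (grPieceSelf I n)
  map_smul' r z := by
    simp only [ZeroHom.toFun_eq_coe, AddMonoidHom.toZeroHom_coe, RingHom.id_apply]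
    induction r using GrRing.induction with
    | zero => simp only [zero_smul, map_zero]
    | add x y hx hy => simp only [add_smul, map_add, hx, hy]
    | of i a ha =>
      induction z using GrModule.induction with
      | zero => simp only [smul_zero, map_zero]
      | add x y hx hy => simp only [smul_add, map_add, hx, hy]
      | of j x hx =>
        rw [grRingOf_smul_grOf, toAddMonoid_grPieceSelf_grOf, toAddMonoid_grPieceSelf_grOf]
        exact (grRingOf_mul_grRingOf ha (mem_pow_of_mem_pow_smul_top hx)).symm

theorem grModuleSelf_grOf {n : ℕ} {a : A} (ha : a ∈ I ^ n • (⊤ : Submodule A A)) :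
    grModuleSelf I (grOf n a ha) = grRingOf n a (mem_pow_of_mem_pow_smul_top ha) :=
  toAddMonoid_grPieceSelf_grOf ha

/-- `I^n M` is spanned by products `a • y`, and the class of such a product is the class of `a` in
degree `n` acting on the class of `y` in degree 0. -/
theorem generatedInDegree_zero_grModuleGrading (M : Type v) [AddCommGroup M] [Module A M] :
    GeneratedInDegree (GrRing I) (grModuleGrading I M) 0 := by
  refine eq_top_iff.2 ?_
  rintro z -
  induction z using GrModule.induction with
  | zero => exact zero_mem _
  | add x y hx hy => exact add_mem hx hy
  | of n x hx =>
    refine Submodule.smul_induction_on' hx (p := fun x hx => grOf n x hx ∈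
      Submodule.span (GrRing I) (grModuleGrading I M 0 : Set (GrModule I M))) ?_ ?_
    · intro a ha y _
      have h : grRingOf n a ha • grOf 0 y (mem_pow_zero_smul_top y) ∈
          Submodule.span (GrRing I) (grModuleGrading I M 0 : Set (GrModule I M)) :=
        Submodule.smul_mem _ _ (Submodule.subset_span
          (mem_grModuleGrading_natCast_iff.2 ⟨_, _, rfl⟩))
      rw [grRingOf_smul_grOf] at h
      exact h
    · intro x hx y hy h1 h2
      rw [grOf_add _ hx hy]
      exact add_mem h1 h2

variable (I) in
/-- The class in degree `0` of a basis vector. -/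
noncomputable def grSingle (ι : Type w) (i : ι) : GrModule I (ι →₀ A) :=
  grOf 0 (Finsupp.single i 1) (mem_pow_zero_smul_top _)

theorem linearIndependent_grSingle (ι : Type w) :
    LinearIndependent (GrRing I) (grSingle I ι) := by
  classical
  refine linearIndependent_iff.2 fun l hl => Finsupp.ext fun i => ?_
  -- The `i`-th coordinate map `A^(ι) → A` induces a functional on the associated graded module that
  -- is dual to the basis classes, so it reads off the `i`-th coefficient of a linear combination.
  have key : (grModuleSelf I ∘ₗ grMap (Finsupp.lapply i) 0 (range_le_pow_zero _)) ∘ₗ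
      Finsupp.linearCombination (GrRing I) (grSingle I ι) = Finsupp.lapply i := by
    refine Finsupp.lhom_ext fun j r => ?_
    rw [LinearMap.comp_apply, Finsupp.linearCombination_single, map_smul, LinearMap.comp_apply,
      grSingle, grMap_grOf, grModuleSelf_grOf, Finsupp.lapply_apply (R := GrRing I)]
    obtain rfl | hne := eq_or_ne j i
    · have : grRingOf (I := I) (0 + 0) (Finsupp.lapply (R := A) j (Finsupp.single j (1 : A)))
          (mem_pow_zero _) = 1 := by
        simp only [Finsupp.lapply_apply, Finsupp.single_eq_same]; rfl
      rw [this, Finsupp.single_eq_same, smul_eq_mul, mul_one]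
    · rw [(grRingOf_eq_zero_iff _).2, smul_zero, Finsupp.single_eq_of_ne hne.symm]
      rw [Finsupp.lapply_apply, Finsupp.single_eq_of_ne hne.symm]
      exact zero_mem _
  rw [← Finsupp.lapply_apply (R := GrRing I), ← key, LinearMap.comp_apply, hl, map_zero]
  rfl

theorem span_grSingle (ι : Type w) :
    ⊤ ≤ Submodule.span (GrRing I) (Set.range (grSingle I ι)) := by
  rw [← generatedInDegree_zero_grModuleGrading, Submodule.span_le]
  intro z hz
  obtain ⟨x, hx, rfl⟩ := mem_grModuleGrading_natCast_iff.1 hz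
  rw [SetLike.mem_coe]
  induction x using Finsupp.induction_linear with
  | zero => rw [(grOf_eq_zero_iff _).2 (zero_mem _)]; exact zero_mem _
  | add f g hf hg =>
    rw [grOf_add 0 (mem_pow_zero_smul_top f) (mem_pow_zero_smul_top g)]
    exact add_mem (hf _ (mem_grModuleGrading_natCast_iff.2 ⟨_, _, rfl⟩))
      (hg _ (mem_grModuleGrading_natCast_iff.2 ⟨_, _, rfl⟩))
  | single i a =>
    have h : grOf 0 (Finsupp.single i a) hx =
        grRingOf (I := I) 0 a (mem_pow_zero a) • grSingle I ι i := by
      rw [grSingle, grRingOf_smul_grOf]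
      exact grOf_congr rfl (by simp) _ _
    rw [h]
    exact Submodule.smul_mem _ _ (Submodule.subset_span ⟨i, rfl⟩)

/-- `P` is a retract of the free module `P →₀ A`, and `grMap` carries the section and the retraction
to the associated graded modules. -/
theorem projective_grModule (P : Type v) [AddCommGroup P] [Module A P] [Module.Projective A P] :
    Module.Projective (GrRing I) (GrModule I P) := by
  obtain ⟨s, hs⟩ := Module.projective_def'.1 (inferInstance : Module.Projective A P)
  have : Module.Free (GrRing I) (GrModule I (P →₀ A)) :=
    Module.Free.of_basis (Module.Basis.mk (linearIndependent_grSingle P) (span_grSingle P))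
  refine Module.Projective.of_split (grMap s 0 (range_le_pow_zero _))
    (grMap (Finsupp.linearCombination A id) 0 (range_le_pow_zero _)) (LinearMap.ext fun z => ?_)
  induction z using GrModule.induction with
  | zero => simp only [map_zero]
  | add x y hx hy => simp only [map_add, hx, hy]
  | of n x hx =>
    rw [LinearMap.comp_apply, grMap_grOf, grMap_grOf]
    exact grOf_congr rfl (LinearMap.congr_fun hs x) _ _

end Projective

/-! ### Internal direct sums of subgroups -/

section Internal

variable {M : Type v} [AddCommGroup M] {N : Type w} [AddCommGroup N]

theorem isInternal_addSubgroup_iff {ι : Type*} [DecidableEq ι] (ℳ : ι → AddSubgroup M) :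
    DirectSum.IsInternal ℳ ↔ iSupIndep ℳ ∧ iSup ℳ = ⊤ := by
  have h := DirectSum.isInternal_submodule_iff_iSupIndep_and_iSup_eq_top
    (fun i => AddSubgroup.toIntSubmodule (ℳ i))
  have h1 : iSupIndep (fun i => AddSubgroup.toIntSubmodule (ℳ i)) ↔ iSupIndep ℳ :=
    iSupIndep_map_orderIso_iff AddSubgroup.toIntSubmodule
  rw [h1, ← OrderIso.map_iSup, ← AddSubgroup.toIntSubmodule.map_top,
    AddSubgroup.toIntSubmodule.injective.eq_iff] at h
  exact h

theorem IsInternal.comp_equiv {ι κ : Type*} [DecidableEq ι] [DecidableEq κ]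
    {ℳ : ι → AddSubgroup M} (h : DirectSum.IsInternal ℳ) (e : κ ≃ ι) :
    DirectSum.IsInternal fun k => ℳ (e k) := by
  rw [isInternal_addSubgroup_iff] at h ⊢
  exact ⟨h.1.comp e.injective, (e.iSup_comp (g := ℳ)).trans h.2⟩

theorem IsInternal.map_addEquiv {ι : Type*} [DecidableEq ι]
    {ℳ : ι → AddSubgroup M} (h : DirectSum.IsInternal ℳ) (e : M ≃+ N) :
    DirectSum.IsInternal fun i => (ℳ i).map e.toAddMonoidHom := by
  rw [isInternal_addSubgroup_iff] at h ⊢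
  refine ⟨(iSupIndep_map_orderIso_iff e.mapAddSubgroup).2 h.1, ?_⟩
  rw [← AddSubgroup.map_iSup, h.2]
  exact AddSubgroup.map_top_of_surjective _ e.surjective

end Internal

/-! ### Gradings and their shifts -/

section Grading

variable {A : Type u} [Ring A] (I : Ideal A) (M : Type v) [AddCommGroup M] [Module A M]

theorem isInternal_grModuleGrading : DirectSum.IsInternal (grModuleGrading I M) :=
  letI : DirectSum.Decomposition (grModuleGrading I M) :=
    DirectSum.Decomposition.ofAddHom _
      (DirectSum.toAddMonoid fun n =>
        (DirectSum.of (fun j => grModuleGrading I M j) (Int.ofNat n)).comp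
          (DirectSum.of (GrModulePiece I M) n).rangeRestrict)
      (by
        ext n x : 2
        simp only [AddMonoidHom.comp_apply, DirectSum.toAddMonoid_of, AddMonoidHom.id_apply]
        exact DirectSum.coeAddMonoidHom_of (grModuleGrading I M) (Int.ofNat n) _)
      (by
        ext j x : 2
        match j, x with
        | .ofNat n, ⟨_, z, rfl⟩ =>
          simp only [AddMonoidHom.comp_apply, DirectSum.toAddMonoid_of,
            DirectSum.coeAddMonoidHom_of, AddMonoidHom.id_apply]
          rfl
        | .negSucc n, x => rw [show x = 0 from Subtype.ext x.2, map_zero, map_zero])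
  DirectSum.Decomposition.isInternal _

variable [I.IsTwoSided]

/-- The shift by `s = n` in the `n`-th term of a complex turns differentials of degree one into
degree-preserving maps. -/
theorem isGradedModule_grModuleGrading_sub (s : ℤ) :
    IsGradedModule (grRingGrading I) fun j => grModuleGrading I M (j - s) where
  isInternal := IsInternal.comp_equiv (isInternal_grModuleGrading I M) (Equiv.subRight s)
  smul_mem i j r z hr hz := by
    obtain ⟨a, ha, rfl⟩ := mem_grRingGrading_iff.1 hr
    obtain rfl | ⟨n, x, hx, hj, rfl⟩ := mem_grModuleGrading_iff.1 hz
    · rw [smul_zero]; exact zero_mem _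
    · rw [grRingOf_smul_grOf, add_sub_assoc, hj, ← Nat.cast_add]
      exact mem_grModuleGrading_natCast_iff.2 ⟨_, _, rfl⟩

theorem isGradedModule_grModuleGrading : IsGradedModule (grRingGrading I) (grModuleGrading I M) := by
  simpa only [sub_zero] using isGradedModule_grModuleGrading_sub I M 0

end Grading

/-! ### Exactness of the associated graded sequence -/

section Exact

variable {A : Type u} [Ring A] {I : Ideal A} [I.IsTwoSided]
variable {L : Type*} [AddCommGroup L] [Module A L] {M : Type v} [AddCommGroup M] [Module A M]
  {N : Type w} [AddCommGroup N] [Module A N]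

/-- A class killed by `Gr g` need not lift to an element of `Ker g`. Strictness of `g` (`hrange`)
corrects the representative by a term one filtration step deeper so that it lies in `Ker g`;
strictness of `f` (`hker`) then gives it a preimage in the right filtration degree. The degree `t`
is 1 for a differential and 0 for the augmentation. -/
theorem exact_grMap {f : L →ₗ[A] M} {g : M →ₗ[A] N} (hfg : Function.Exact f g) (t : ℕ)
    (hf : LinearMap.range f ≤ I ^ 1 • (⊤ : Submodule A M))
    (hg : LinearMap.range g ≤ I ^ t • (⊤ : Submodule A N))
    (hker : ∀ n, LinearMap.ker g ⊓ I ^ (n + 1) • (⊤ : Submodule A M) ≤ I ^ n • LinearMap.ker g)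
    (hrange : ∀ n, LinearMap.range g ⊓ I ^ (n + t) • (⊤ : Submodule A N) ≤
      I ^ n • LinearMap.range g) :
    Function.Exact (grMap f 1 hf) (grMap g t hg) := by
  have hfk : LinearMap.ker g = LinearMap.range f := LinearMap.exact_iff.1 hfg
  intro z
  constructor
  · intro hz
    refine mem_of_grMap_eq_zero (S := LinearMap.range (grMap f 1 hf)) g t hg (fun n y hy h0 => ?_) hz
    rw [grMap_grOf, grOf_eq_zero_iff, show n + t + 1 = n + 1 + t by omega] at h0
    -- As `g y` lies one step deeper than its degree predicts, it equals `g y'` with `y' ∈ I^(n+1)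
    -- M`; thus `y - y'` is in the kernel and has the same class as `y`.
    have h1 := hrange (n + 1) ⟨⟨y, rfl⟩, h0⟩
    rw [← Submodule.map_top, ← Submodule.map_smul''] at h1
    obtain ⟨y', hy', hyy'⟩ := h1
    have hy'n : y' ∈ I ^ n • (⊤ : Submodule A M) :=
      Submodule.smul_mono (Ideal.pow_le_pow_right (Nat.le_succ n)) le_rfl hy'
    have hk : y - y' ∈ LinearMap.ker g := by
      rw [LinearMap.mem_ker, map_sub, hyy', sub_self]
    -- The image of `Gr f` starts in degree 1, so in degree 0 the class itself must vanish: it does,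
    -- because `Ker g = range f ⊆ I M`.
    cases n with
    | zero =>
      have : y ∈ I ^ (0 + 1) • (⊤ : Submodule A M) := by
        rw [hfk] at hk
        simpa using add_mem (hf hk) hy'
      rw [(grOf_eq_zero_iff _).2 this]
      exact zero_mem _
    | succ m =>
      have h2 := hker m ⟨hk, sub_mem hy hy'n⟩
      rw [hfk, ← Submodule.map_top, ← Submodule.map_smul''] at h2
      obtain ⟨x, hx, hxy⟩ := h2
      refine ⟨grOf m x hx, ?_⟩
      rw [grMap_grOf, grOf_eq_iff, hxy, sub_sub_cancel_left]
      exact neg_mem hy'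
  · rintro ⟨x, rfl⟩
    induction x using GrModule.induction with
    | zero => simp only [map_zero]
    | add x y hx hy => simp only [map_add, hx, hy, add_zero]
    | of n x hx =>
      rw [grMap_grOf, grMap_grOf, grOf_eq_zero_iff, hfg.apply_apply_eq_zero]
      exact zero_mem _

theorem grMap_surjective {g : M →ₗ[A] N} (hg : Function.Surjective g) :
    Function.Surjective (grMap (I := I) g 0 (range_le_pow_zero g)) := by
  intro z
  induction z using GrModule.induction with
  | zero => exact ⟨0, map_zero _⟩
  | add x y hx hy =>
    obtain ⟨x, rfl⟩ := hx
    obtain ⟨y, rfl⟩ := hy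
    exact ⟨x + y, map_add _ _ _⟩
  | of n y hy =>
    have h := hy
    rw [← LinearMap.range_eq_top.2 hg, ← Submodule.map_top, ← Submodule.map_smul''] at h
    obtain ⟨x, hx, rfl⟩ := h
    exact ⟨grOf n x hx, grMap_grOf _ _ _ _⟩

end Exact

/-! ### Koszul modules -/

section Koszul

variable {A : Type u} [Ring A] (𝒜 : ℕ → AddSubgroup A) [GradedRing 𝒜]
variable {M : Type v} [AddCommGroup M] [Module A M]

variable {𝒜} in
/-- The associated graded complex of a resolution as in the definition of a Koszul module. -/
def GradedProjectiveResolution.gr {ℳ : ℤ → AddSubgroup M}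
    (R : GradedProjectiveResolution.{u, v, w} 𝒜 ℳ)
    (hmin : R.IsMinimal) (hker : ∀ n k : ℕ, gradedJacobson 𝒜 ^ k • R.kernel n =
      R.kernel n ⊓ gradedJacobson 𝒜 ^ (k + 1) • (⊤ : Submodule A (R.P n))) :
    GradedProjectiveResolution.{u, v, w} (grRingGrading (gradedJacobson 𝒜))
      (grModuleGrading (gradedJacobson 𝒜) M) :=
  have hmin' (n : ℕ) :
      LinearMap.range (R.d n) ≤ gradedJacobson 𝒜 ^ 1 • (⊤ : Submodule A (R.P n)) := by
    rw [Submodule.pow_one]; exact hmin n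
  { P := fun n => GrModule (gradedJacobson 𝒜) (R.P n)
    addCommGroup := fun n => inferInstance
    module := fun n => inferInstance
    grading := fun n j => grModuleGrading (gradedJacobson 𝒜) (R.P n) (j - n)
    isGraded := fun n => isGradedModule_grModuleGrading_sub _ _ _
    projective := fun n =>
      haveI := R.projective n
      projective_grModule _
    d := fun n => grMap (R.d n) 1 (hmin' n)
    ε := grMap R.ε 0 (range_le_pow_zero _)
    d_mem := fun n i x hx => by
      have := grMap_mem_grModuleGrading (R.d n) 1 (hmin' n) hx
      rwa [show i - ((n + 1 : ℕ) : ℤ) + (1 : ℕ) = i - n by push_cast; ring] at this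
    ε_mem := fun i x hx => by
      have := grMap_mem_grModuleGrading R.ε 0 (range_le_pow_zero _) hx
      rwa [show i - ((0 : ℕ) : ℤ) + (0 : ℕ) = i by simp] at this
    exact := fun n => by
      -- Both strictness conditions are instances of `hker`: at `n + 1` for the kernel of `d n`, and
      -- at `n` for its range, which is the kernel of the map leaving `P n`.
      refine exact_grMap (R.exact n) 1 _ _ (fun k => (hker (n + 1) k).ge) fun k => ?_
      have h : R.kernel n = LinearMap.range (R.d n) := by
        cases n with
        | zero => exact LinearMap.exact_iff.1 R.exact_zero
        | succ n => exact LinearMap.exact_iff.1 (R.exact n)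
      rw [← h]
      exact (hker n k).ge
    exact_zero := by
      refine exact_grMap R.exact_zero 0 _ _ (fun k => (hker 0 k).ge) fun k => ?_
      rw [LinearMap.range_eq_top.2 R.surjective, add_zero]
      exact inf_le_right
    surjective := grMap_surjective R.surjective }

/-- The degree 0 part is `A / J`. Every element of `A` is congruent modulo `J` to its degree 0
component, so `A_0` surjects onto it, and `J(A_0) ⊆ J` is killed. -/
theorem isSemisimpleRing_grRingGrading_zero (h : IsSemisimpleRing (𝒜 0 ⧸ Ring.jacobson (𝒜 0))) :
    IsSemisimpleRing (grRingGrading (gradedJacobson 𝒜) 0) := by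
  let φ : 𝒜 0 →+* grRingGrading (gradedJacobson 𝒜) 0 :=
    { toFun := fun a => ⟨grRingOf 0 (a : A) (mem_pow_zero _), _, rfl⟩
      map_one' := rfl
      map_zero' := Subtype.ext ((grRingOf_eq_zero_iff _).2 (zero_mem _))
      map_mul' := fun a b => Subtype.ext
        (grRingOf_mul_grRingOf (mem_pow_zero (a : A)) (mem_pow_zero (b : A))).symm
      map_add' := fun a b => Subtype.ext (by
        change grRingOf 0 _ _ = grRingOf 0 _ _ + grRingOf 0 _ _
        unfold grRingOf
        rw [← map_add, ← map_add]; rfl) }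
  have hφ : Function.Surjective φ := by
    rintro ⟨z, hz⟩
    obtain ⟨a, ha, rfl⟩ := mem_grRingGrading_iff.1 hz
    refine ⟨GradedRing.projZeroRingHom' 𝒜 a, Subtype.ext ?_⟩
    change grRingOf 0 _ _ = grRingOf 0 _ _
    unfold grRingOf
    congr 1
    rw [GrRingPiece.mk_eq_iff, zero_add, Submodule.pow_one]
    change GradedRing.projZeroRingHom' 𝒜 _ ∈ Ring.jacobson (𝒜 0)
    rw [map_sub, GradedRing.projZeroRingHom'_apply_coe, sub_self]
    exact zero_mem _
  have hker (a : 𝒜 0) (ha : a ∈ Ring.jacobson (𝒜 0)) : φ a = 0 := by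
    refine Subtype.ext ((grRingOf_eq_zero_iff _).2 ?_)
    rw [zero_add, Submodule.pow_one]
    change GradedRing.projZeroRingHom' 𝒜 _ ∈ Ring.jacobson (𝒜 0)
    rwa [GradedRing.projZeroRingHom'_apply_coe]
  exact (Ideal.Quotient.lift _ φ hker).isSemisimpleRing_of_surjective
    (Ideal.Quotient.lift_surjective_of_surjective _ hker hφ)

theorem IsKoszulModule.isClassicallyKoszulModule_gr
    (h : IsSemisimpleRing (𝒜 0 ⧸ Ring.jacobson (𝒜 0))) {ℳ : ℤ → AddSubgroup M}
    (hM : IsKoszulModule 𝒜 ℳ) :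
    IsClassicallyKoszulModule (grRingGrading (gradedJacobson 𝒜))
      (grModuleGrading (gradedJacobson 𝒜) M) := by
  obtain ⟨-, R, hmin, hker⟩ := hM
  refine ⟨isSemisimpleRing_grRingGrading_zero 𝒜 h, isGradedModule_grModuleGrading _ _,
    generatedInDegree_zero_grModuleGrading M, R.gr hmin hker, fun n => ?_⟩
  have := generatedInDegree_zero_grModuleGrading (I := gradedJacobson 𝒜) (R.P n)
  -- The component of degree `n` in the grading shifted by `n` is the original component of degree
  -- 0.
  rw [← sub_self (n : ℤ)] at this
  exact this

variable {𝒜} in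
/-- Being classically Koszul is invariant under isomorphisms of graded modules. -/
theorem IsClassicallyKoszulModule.of_linearEquiv {N : Type v} [AddCommGroup N] [Module A N]
    {ℳ : ℤ → AddSubgroup M} {𝒩 : ℤ → AddSubgroup N} (h : IsClassicallyKoszulModule 𝒜 ℳ)
    (e : M ≃ₗ[A] N) (he : ∀ j, 𝒩 j = (ℳ j).map (e : M →ₗ[A] N).toAddMonoidHom) :
    IsClassicallyKoszulModule 𝒜 𝒩 := by
  obtain ⟨hss, hgr, hgen, R, hR⟩ := h
  refine ⟨hss, ⟨?_, ?_⟩, ?_, { R with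
    ε := e.toLinearMap ∘ₗ R.ε
    ε_mem := fun i x hx => by
      rw [he]; exact ⟨_, R.ε_mem i x hx, rfl⟩
    exact_zero := fun x => by
      rw [LinearMap.comp_apply, LinearEquiv.coe_coe, e.map_eq_zero_iff]
      exact R.exact_zero x
    surjective := e.surjective.comp R.surjective }, hR⟩
  · obtain rfl : 𝒩 = _ := funext he
    exact IsInternal.map_addEquiv hgr.isInternal e.toAddEquiv
  · intro i j a m ha hm
    rw [he] at hm ⊢
    obtain ⟨m, hm, rfl⟩ := hm
    exact ⟨a • m, hgr.smul_mem i j a m ha hm, map_smul e a m⟩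
  · have h0 : (𝒩 0 : Set N) = e.toLinearMap '' (ℳ 0) := by rw [he]; rfl
    rw [GeneratedInDegree, h0, Submodule.span_image, hgen, Submodule.map_top,
      LinearEquiv.range]

end Koszul

/-! ### The trivial module and Koszul rings -/

section Quotient

variable {A : Type u} [Ring A] {I : Ideal A}

theorem mkQ_mem_pow_smul_top {n : ℕ} {a : A} (ha : a ∈ I ^ n) :
    I.mkQ a ∈ I ^ n • (⊤ : Submodule A (A ⧸ I)) := by
  have := Submodule.smul_mem_smul ha (Submodule.mem_top (x := I.mkQ (1 : A)))
  rwa [← map_smul, smul_eq_mul, mul_one] at this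

variable [I.IsTwoSided]

variable (I) in
/-- The class of `1` generates the associated graded module of `A / I`. -/
def grQuotientProj : GrRing I →ₗ[GrRing I] GrModule I (A ⧸ I) :=
  LinearMap.toSpanSingleton _ _ (grOf 0 (I.mkQ 1) (mem_pow_zero_smul_top _))

theorem grQuotientProj_grRingOf {n : ℕ} {a : A} (ha : a ∈ I ^ n) :
    grQuotientProj I (grRingOf n a ha) = grOf n (I.mkQ a) (mkQ_mem_pow_smul_top ha) := by
  rw [grQuotientProj, LinearMap.toSpanSingleton_apply, grRingOf_smul_grOf]
  refine grOf_congr (add_zero n) ?_ _ _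
  rw [← map_smul, smul_eq_mul, mul_one]

theorem map_grQuotientProj_grRingGrading (n : ℕ) :
    (grRingGrading I n).map (grQuotientProj I).toAddMonoidHom =
      grModuleGrading I (A ⧸ I) n := by
  ext z
  rw [mem_grModuleGrading_natCast_iff]
  constructor
  · rintro ⟨z, hz, rfl⟩
    obtain ⟨a, ha, rfl⟩ := mem_grRingGrading_iff.1 hz
    exact ⟨_, _, (grQuotientProj_grRingOf ha).symm⟩
  · rintro ⟨x, hx, rfl⟩
    have h := hx
    rw [← Submodule.range_mkQ, ← Submodule.map_top, ← Submodule.map_smul''] at h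
    obtain ⟨a, ha, rfl⟩ := h
    exact ⟨_, mem_grRingGrading_iff.2 ⟨a, mem_pow_of_mem_pow_smul_top ha, rfl⟩,
      grQuotientProj_grRingOf _⟩

theorem grQuotientProj_surjective : Function.Surjective (grQuotientProj I) := by
  rw [← LinearMap.range_eq_top, eq_top_iff, ← generatedInDegree_zero_grModuleGrading,
    Submodule.span_le]
  intro z hz
  have hz : z ∈ grModuleGrading I (A ⧸ I) (0 : ℕ) := hz
  rw [← map_grQuotientProj_grRingGrading] at hz
  obtain ⟨r, -, rfl⟩ := hz
  exact ⟨r, rfl⟩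

/-- Hence the associated graded module of `A / I` is concentrated in degree 0. -/
theorem pow_succ_smul_top_quotient (n : ℕ) : I ^ (n + 1) • (⊤ : Submodule A (A ⧸ I)) = ⊥ := by
  rw [← Submodule.range_mkQ, ← Submodule.map_top, ← Submodule.map_smul'', eq_bot_iff]
  rintro _ ⟨a, ha, rfl⟩
  have := Ideal.pow_le_pow_right (Nat.le_add_left 1 n) (mem_pow_of_mem_pow_smul_top ha)
  rw [Submodule.pow_one] at this
  exact (Submodule.Quotient.mk_eq_zero I).2 this

/-- If two left ideals of `GrRing I` contain the elements of positive degree, and the first contains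
no nonzero element of degree `0`, then the first is contained in the second. -/
theorem le_of_grRingOf_mem {S T : Ideal (GrRing I)}
    (hS : ∀ n a (ha : a ∈ I ^ (n + 1)), grRingOf (n + 1) a ha ∈ S)
    (hT : ∀ n a (ha : a ∈ I ^ (n + 1)), grRingOf (n + 1) a ha ∈ T)
    (h0 : ∀ a (ha : a ∈ I ^ 0), grRingOf 0 a ha ∈ S → grRingOf 0 a ha = 0) : S ≤ T := by
  -- Removing the degree 0 component leaves a sum of elements of positive degree, which both ideals
  -- contain.
  have key (z : GrRing I) : z - DirectSum.of (GrRingPiece I) 0 (z 0) ∈ S ⊓ T := by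
    induction z using GrRing.induction with
    | zero => simp only [DirectSum.zero_apply, map_zero, sub_zero, zero_mem]
    | add x y hx hy =>
      rw [DirectSum.add_apply, map_add, add_sub_add_comm]
      exact add_mem hx hy
    | of n a ha =>
      cases n with
      | zero => rw [grRingOf, DirectSum.of_eq_same, sub_self]; exact zero_mem _
      | succ n =>
        rw [grRingOf, DirectSum.of_eq_of_ne _ _ _ (by omega), map_zero, sub_zero]
        exact ⟨hS n a ha, hT n a ha⟩
  intro z hz
  obtain ⟨a, ha, h⟩ := exists_grRingOf_eq 0 (z 0)
  have hz' := key z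
  rw [← h] at hz'
  have h1 : grRingOf 0 a ha = 0 := h0 a ha (by simpa using sub_mem hz hz'.1)
  rw [h1, sub_zero] at hz'
  exact hz'.2

theorem mem_positivePart_iff {B : Type u} [Ring B] (ℬ : ℕ → AddSubgroup B) [GradedRing ℬ]
    {b : B} : b ∈ positivePart ℬ ↔ (DirectSum.decompose ℬ b 0 : B) = 0 := by
  rw [positivePart, RingHom.mem_ker, ← ZeroMemClass.coe_eq_zero]
  rfl

/-- Positive degrees are killed since the target lives in degree 0; in degree 0 the map is the
identity of `A / I`, hence injective. -/
theorem ker_grQuotientProj : LinearMap.ker (grQuotientProj I) = positivePart (grRingGrading I) := by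
  have hmem {n : ℕ} {a : A} (ha : a ∈ I ^ n) : grRingOf n a ha ∈ grRingGrading I n := ⟨_, rfl⟩
  have h1 (n) (a : A) (ha : a ∈ I ^ (n + 1)) :
      grRingOf (n + 1) a ha ∈ LinearMap.ker (grQuotientProj I) := by
    rw [LinearMap.mem_ker, grQuotientProj_grRingOf, grOf_eq_zero_iff]
    have := mkQ_mem_pow_smul_top ha
    rw [pow_succ_smul_top_quotient, Submodule.mem_bot] at this
    rw [this]
    exact zero_mem _
  have h2 (n) (a : A) (ha : a ∈ I ^ (n + 1)) :
      grRingOf (n + 1) a ha ∈ positivePart (grRingGrading I) := by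
    rw [mem_positivePart_iff]
    exact DirectSum.decompose_of_mem_ne _ (hmem ha) n.succ_ne_zero
  refine le_antisymm (le_of_grRingOf_mem h1 h2 fun a ha h => ?_)
    (le_of_grRingOf_mem h2 h1 fun a ha h => ?_)
  · rw [LinearMap.mem_ker, grQuotientProj_grRingOf, grOf_eq_zero_iff,
      pow_succ_smul_top_quotient, Submodule.mem_bot] at h
    rw [grRingOf_eq_zero_iff, zero_add, Submodule.pow_one]
    exact (Submodule.Quotient.mk_eq_zero I).1 h
  · rwa [mem_positivePart_iff, DirectSum.decompose_of_mem_same _ (hmem ha)] at h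

theorem isClassicallyKoszulRing_grRing
    (h : IsClassicallyKoszulModule (grRingGrading I) (grModuleGrading I (A ⧸ I))) :
    IsClassicallyKoszulRing (grRingGrading I) := by
  let e : (GrRing I ⧸ positivePart (grRingGrading I)) ≃ₗ[GrRing I] GrModule I (A ⧸ I) :=
    (Submodule.quotEquivOfEq _ _ ker_grQuotientProj.symm).trans
      ((grQuotientProj I).quotKerEquivOfSurjective grQuotientProj_surjective)
  refine h.of_linearEquiv e.symm fun j => ?_
  match j with
  | .ofNat n =>
    have hn : grModuleGrading I (A ⧸ I) (Int.ofNat n) = _ :=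
      (map_grQuotientProj_grRingGrading (I := I) n).symm
    rw [hn, AddSubgroup.map_map]
    refine congrArg (fun f => (grRingGrading I n).map f) (AddMonoidHom.ext fun r => ?_)
    -- By construction `e` sends the class of `r` to `grQuotientProj I r`, so `e.symm` carries the
    -- grading of the target to the quotient grading.
    exact (e.symm_apply_eq.2 rfl).symm
  | .negSucc n => exact (AddSubgroup.map_bot _).symm

end Quotient

end GradedKoszul

theorem theorem5 {A : Type u} [Ring A] (𝒜 : ℕ → AddSubgroup A) [GradedRing 𝒜]
    (hnoeth : IsNoetherianRing (𝒜 0)) (hsemiperfect : IsSemiperfectRing (𝒜 0))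
    (hfinite : LeftFinite 𝒜) (hgen : GeneratedInDegreeOne 𝒜) :
    (∀ (M : Type v) [AddCommGroup M] [Module A M] (ℳ : ℤ → AddSubgroup M),
      IsKoszulModule 𝒜 ℳ →
        IsClassicallyKoszulModule (grRingGrading (gradedJacobson 𝒜))
          (grModuleGrading (gradedJacobson 𝒜) M)) ∧
    (IsKoszulRing 𝒜 → IsClassicallyKoszulRing (grRingGrading (gradedJacobson 𝒜))) := by
  refine ⟨fun M _ _ ℳ hM => hM.isClassicallyKoszulModule_gr 𝒜 hsemiperfect.semisimple, fun hA => ?_⟩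
  exact isClassicallyKoszulRing_grRing
    (IsKoszulModule.isClassicallyKoszulModule_gr 𝒜 hsemiperfect.semisimple hA)
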